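/- All function spaces below consist of real-valued functions, or all of complex-valued functions; the statement holds in both cases. For a self-mapping $F$ of a set $X$ and a linear topological space $E$ of functions on $X$ that is invariant under $T_F\varphi=\varphi\circ F$, the cohomological equation $\varphi(Fx)-\varphi(x)=\gamma(x)$, $x\in X$, is called normally solvable in $E$ if the image of $T_F-I:E\to E$ is closed in $E$. The mapping $F$ is called preperiodic if $F^{l+p}=F^{l}$ for some integers $l\ge 0$ and $p\ge 1$. All spaces of bounded functions carry the supremum norm. 1. Let $X$ be a compact Hausdorff space and let $F:X\to X$ be continuous. The cohomological equation is normally solvable in the space $C(X)$ of continuous functions if and only if $F$ is preperiodic. 2. Let $X$ be a completely regular Hausdorff space and let $F:X\to X$ be continuous. The cohomological equation is normally solvable in the space $CB(X)$ of bounded continuous functions if and only if $F$ is preperiodic. 3. Let $X$ be any set and let $F:X\to X$ be any mapping. The cohomological equation is normally solvable in the space $B(X)$ of all bounded functions if and only if $F$ is preperiodic. 4. Let $G$ be a Hausdorff topological group and $g\in G$. The equation $\varphi(gx)-\varphi(x)=\gamma(x)$, $x\in G$, is normally solvable in $CB(G)$ if and only if $g$ is of finite order. 5. Let $G$ be a commutative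 topological group whose points are separated by its characters (the continuous homomorphisms from $G$ to the unit circle), and let $g\in G$. Let $AP(G)$ be the space of almost periodic functions, i.e. of those $\psi\in CB(G)$ whose set of shifts $\{\psi(h\,\cdot):h\in G\}$ is precompact in $CB(G)$. The equation $\varphi(gx)-\varphi(x)=\gamma(x)$, $x\in G$, is normally solvable in $AP(G)$ if and only if $g$ is of finite order. -/

import Mathlib

open scoped BoundedContinuousFunction

noncomputable section

namespace CohomEq

/-- A self-mapping is preperiodic if `F^(l+p) = F^l` for some preperiod `l ≥ 0` and
some period `p ≥ 1`. -/
def IsPreperiodic {X : Type*} (F : X → X) : Prop :=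
  ∃ l p : ℕ, 1 ≤ p ∧ F^[l + p] = F^[l]

/-- For a linear operator `T` in a linear topological space `E`, the equation `T φ - φ = γ`
is normally solvable in `E` if the image of `T - I` is closed in `E`. -/
def NormallySolvable {𝕜 E : Type*} [Ring 𝕜] [AddCommGroup E] [Module 𝕜 E]
    [TopologicalSpace E] (T : E →ₗ[𝕜] E) : Prop :=
  IsClosed (Set.range fun φ : E => T φ - φ)

section Koopman

variable (𝕜 : Type*) [RCLike 𝕜]

/-- The Koopman operator `φ ↦ φ ∘ F` in the space `C(X)` of continuous functions. -/
def koopmanC {X : Type*} [TopologicalSpace X] (F : C(X, X)) :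
    C(X, 𝕜) →ₗ[𝕜] C(X, 𝕜) where
  toFun φ := φ.comp F
  map_add' _ _ := rfl
  map_smul' _ _ := rfl

/-- The Koopman operator `φ ↦ φ ∘ F` in the space `CB(X)` of bounded continuous functions
with the supremum norm. -/
def koopmanCB {X : Type*} [TopologicalSpace X] (F : C(X, X)) :
    (X →ᵇ 𝕜) →ₗ[𝕜] (X →ᵇ 𝕜) where
  toFun φ := φ.compContinuous F
  map_add' _ _ := rfl
  map_smul' _ _ := rfl

/-- The Koopman operator `φ ↦ φ ∘ F` in the space `B(X)` of all bounded functions on the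
set `X` with the supremum norm, which is Mathlib's `ℓ^∞` space over the index set `X`. -/
def koopmanB {X : Type*} (F : X → X) :
    lp (fun _ : X => 𝕜) ⊤ →ₗ[𝕜] lp (fun _ : X => 𝕜) ⊤ where
  toFun φ := ⟨fun x => φ (F x), by
    obtain ⟨C, hC⟩ := memℓp_infty_iff.1 φ.2
    refine memℓp_infty_iff.2 ⟨C, ?_⟩
    rintro _ ⟨x, rfl⟩
    exact hC ⟨F x, rfl⟩⟩
  map_add' _ _ := rfl
  map_smul' _ _ := rfl

end Koopman

section AlmostPeriodic

variable (𝕜 : Type*) [RCLike 𝕜] (G : Type*) [TopologicalSpace G] [Group G] [ContinuousMul G]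

/-- The operator `ψ ↦ ψ(g ·)` in `CB(G)`: the Koopman operator of the shift `x ↦ g x`. -/
def shiftCB (g : G) : (G →ᵇ 𝕜) →ₗ[𝕜] (G →ᵇ 𝕜) :=
  koopmanCB 𝕜 (ContinuousMap.mulLeft g)

/-- The space `AP(G)` of almost periodic functions, as a subspace of `CB(G)`: those bounded
continuous functions whose set of shifts is precompact (totally bounded) in `CB(G)`. -/
def AP : Submodule 𝕜 (G →ᵇ 𝕜) where
  carrier := {ψ | TotallyBounded (Set.range fun g : G => shiftCB 𝕜 G g ψ)}
  add_mem' {ψ₁ ψ₂} h₁ h₂ := by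
    refine Metric.totallyBounded_iff.2 fun ε hε => ?_
    obtain ⟨t₁, ht₁, hs₁⟩ := Metric.totallyBounded_iff.1 h₁ (ε / 2) (half_pos hε)
    obtain ⟨t₂, ht₂, hs₂⟩ := Metric.totallyBounded_iff.1 h₂ (ε / 2) (half_pos hε)
    refine ⟨Set.image2 (· + ·) t₁ t₂, ht₁.image2 _ ht₂, ?_⟩
    rintro _ ⟨g, rfl⟩
    obtain ⟨u₁, hu₁, hd₁⟩ := Set.mem_iUnion₂.1 (hs₁ ⟨g, rfl⟩)
    obtain ⟨u₂, hu₂, hd₂⟩ := Set.mem_iUnion₂.1 (hs₂ ⟨g, rfl⟩)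
    refine Set.mem_iUnion₂.2 ⟨u₁ + u₂, Set.mem_image2_of_mem hu₁ hu₂, ?_⟩
    have h := dist_add_add_le (shiftCB 𝕜 G g ψ₁) (shiftCB 𝕜 G g ψ₂) u₁ u₂
    rw [Metric.mem_ball] at hd₁ hd₂ ⊢
    simp only [map_add]
    linarith
  zero_mem' := by
    refine (totallyBounded_singleton (0 : G →ᵇ 𝕜)).subset ?_
    rintro _ ⟨g, rfl⟩
    exact map_zero (shiftCB 𝕜 G g)
  smul_mem' c ψ h := by
    refine (TotallyBounded.image h (uniformContinuous_const_smul (X := G →ᵇ 𝕜) c)).subset ?_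
    rintro _ ⟨g, rfl⟩
    exact ⟨shiftCB 𝕜 G g ψ, ⟨g, rfl⟩, (map_smul (shiftCB 𝕜 G g) c ψ).symm⟩

theorem shiftCB_mem_AP (g : G) (ψ : G →ᵇ 𝕜) (h : ψ ∈ AP 𝕜 G) : shiftCB 𝕜 G g ψ ∈ AP 𝕜 G := by
  refine TotallyBounded.subset ?_ h
  rintro _ ⟨a, rfl⟩
  refine ⟨g * a, ?_⟩
  ext x
  exact congrArg ψ (mul_assoc g a x)

/-- The operator `ψ ↦ ψ(g ·)` in `AP(G)`. -/
def shiftAP (g : G) : AP 𝕜 G →ₗ[𝕜] AP 𝕜 G :=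
  (shiftCB 𝕜 G g).restrict fun ψ h => shiftCB_mem_AP 𝕜 G g ψ h

end AlmostPeriodic

end CohomEq

end

/-! If `F^(l+p) = F^l`, the operator `T` satisfies `T^(l+p) = T^l`, and algebra makes the range of
`T - I` the kernel of a continuous operator, hence closed. Conversely, let the range be closed in a
Banach space. By the open mapping theorem, solutions can be chosen with norm controlled by the
right-hand side. A Birkhoff sum `φ = ∑_{j<n} T^j h` with `‖h‖ ≤ 1` has `‖Tφ - φ‖ = ‖T^n h - h‖ ≤ 2`,
so `T^n φ - φ` is bounded independently of `n`. If `F` is not preperiodic, some orbit has `2n`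
distinct initial points; taking `h` to be 0 on the first `n` and 1 on the next `n` gives `T^n φ - φ`
the value `n` at its start, a contradiction. What varies between the spaces is the construction of
`h`. -/

namespace CohomEq

/-! ### Closed range for contractions -/

section Operators

variable {𝕜 : Type*} [RCLike 𝕜] {E : Type*} [NormedAddCommGroup E] [NormedSpace 𝕜 E]

open Polynomial in
/-- If `T^(l+p) = T^l`, then the range of `T - I` is the kernel of a polynomial in `T`. -/
theorem normallySolvable_of_pow_add_eq (T : E →ₗ[𝕜] E) (hT : ∀ φ, ‖T φ‖ ≤ ‖φ‖) {l p : ℕ}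
    (hp : 1 ≤ p) (h : T ^ (l + p) = T ^ l) : NormallySolvable T := by
  -- `q * (X - 1) = X^(l+p) - X^l` annihilates `T`, while `q(1) = p ≠ 0`. So modulo the range of `T
  -- - 1`, `q(T)` acts as an invertible scalar.
  let q : 𝕜[X] := X ^ l * ∑ i ∈ Finset.range p, X ^ i
  have hq : aeval T q * (T - 1) = 0 := by
    have h1 : q * (X - 1) = X ^ (l + p) - X ^ l := by
      rw [mul_assoc, geom_sum_mul]; ring
    have h2 := congrArg (aeval T) h1
    simpa [h] using h2
  have hq1 : q.eval 1 ≠ 0 := by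
    have : (p : 𝕜) ≠ 0 := Nat.cast_ne_zero.2 (by omega)
    simpa [q, eval_finsetSum] using this
  obtain ⟨r, hr⟩ : X - C 1 ∣ q - C (q.eval 1) := dvd_iff_isRoot.2 (by simp)
  have hr' : ∀ γ, aeval T q γ = T (aeval T r γ) - aeval T r γ + q.eval 1 • γ := by
    intro γ
    have h2 := congrArg (fun S : E →ₗ[𝕜] E => S γ) (congrArg (aeval T) hr)
    simp only [map_sub, map_mul, aeval_X, aeval_C, LinearMap.sub_apply, Module.End.mul_apply,
      Module.algebraMap_end_apply, one_smul] at h2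
    rw [← h2]; abel
  have hcont : Continuous (aeval T q) := by
    let T' : E →L[𝕜] E := T.mkContinuous 1 (by simpa using hT)
    have h3 : ∀ s : 𝕜[X], Continuous (aeval T s) := by
      intro s
      induction s using Polynomial.induction_on' with
      | add a b ha hb =>
        simp only [map_add]
        exact ha.add hb
      | monomial n a =>
        have h4 : ∀ k : ℕ, Continuous (T ^ k) := by
          intro k
          rw [Module.End.coe_pow]
          exact T'.continuous.iterate k
        rw [aeval_monomial]
        exact (h4 n).const_smul a
    exact h3 q
  have hrange : (Set.range fun φ : E => T φ - φ) = {γ | aeval T q γ = 0} := by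
    ext γ
    constructor
    · rintro ⟨φ, rfl⟩
      exact congrArg (fun S : E →ₗ[𝕜] E => S φ) hq
    · intro hγ
      refine ⟨-((q.eval 1)⁻¹ • aeval T r γ), ?_⟩
      have h5 : T (aeval T r γ) - aeval T r γ = -(q.eval 1 • γ) :=
        eq_neg_of_add_eq_zero_left ((hr' γ).symm.trans hγ)
      have h6 : T (-((q.eval 1)⁻¹ • aeval T r γ)) - -((q.eval 1)⁻¹ • aeval T r γ)
          = -((q.eval 1)⁻¹ • (T (aeval T r γ) - aeval T r γ)) := by
        rw [map_neg, map_smul, smul_sub]; abel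
      simp only [h6, h5, smul_neg, neg_neg, inv_smul_smul₀ hq1]
  rw [NormallySolvable, hrange]
  exact isClosed_singleton.preimage hcont

theorem norm_pow_apply_le (T : E →ₗ[𝕜] E) (hT : ∀ φ, ‖T φ‖ ≤ ‖φ‖) (n : ℕ) (φ : E) :
    ‖(T ^ n) φ‖ ≤ ‖φ‖ := by
  induction n with
  | zero => simp
  | succ n ih =>
    rw [pow_succ', Module.End.mul_apply]
    exact (hT _).trans ih

/-- If the range of `T - I` is closed for a contraction `T`, then the open mapping theorem bounds
the increments over `n` steps of Birkhoff sums of length `n`, uniformly in `n`. -/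
theorem NormallySolvable.exists_bound [CompleteSpace E] {T : E →ₗ[𝕜] E}
    (hT : ∀ φ, ‖T φ‖ ≤ ‖φ‖) (hs : NormallySolvable T) :
    ∃ C : ℝ, ∀ (n : ℕ) (h : E), ‖h‖ ≤ 1 →
      ‖(T ^ n) (∑ j ∈ Finset.range n, (T ^ j) h) - ∑ j ∈ Finset.range n, (T ^ j) h‖ ≤ C := by
  let D : E →L[𝕜] E := T.mkContinuous 1 (by simpa using hT) - ContinuousLinearMap.id 𝕜 E
  have hD : ∀ φ, D φ = T φ - φ := fun _ => rfl
  have hclosed : IsClosed (D.range : Set E) := hs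
  have : CompleteSpace D.range := hclosed.completeSpace_coe
  obtain ⟨C, hC, hpre⟩ := ContinuousLinearMap.exists_preimage_norm_le D.rangeRestrict
    D.toLinearMap.surjective_rangeRestrict
  refine ⟨2 * (C * 2), fun n h hh => ?_⟩
  have hgeom : ∀ φ, (T ^ n) φ - φ = ∑ j ∈ Finset.range n, (T ^ j) (T φ - φ) := by
    intro φ
    have := congrArg (fun S : E →ₗ[𝕜] E => S φ) (geom_sum_mul T n)
    simpa [LinearMap.sum_apply] using this.symm
  set φ := ∑ j ∈ Finset.range n, (T ^ j) h with hφ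
  have hγ : D φ = (T ^ n) h - h := by
    rw [hgeom, hD, hφ, map_sum, ← Finset.sum_sub_distrib]
    refine Finset.sum_congr rfl fun j _ => ?_
    rw [map_sub, ← Module.End.mul_apply, ← Module.End.mul_apply, ← pow_succ, ← pow_succ']
  obtain ⟨ψ, hψ, hψn⟩ := hpre (D.rangeRestrict φ)
  have hψ' : T ψ - ψ = T φ - φ := congrArg Subtype.val hψ
  have hn : ‖D.rangeRestrict φ‖ ≤ 2 := by
    change ‖D φ‖ ≤ 2
    rw [hγ]
    have := norm_sub_le ((T ^ n) h) h
    have := norm_pow_apply_le T hT n h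
    linarith
  -- `T^n φ - φ` depends only on `T φ - φ`, so the large `φ` may be replaced by the controlled
  -- solution `ψ`.
  rw [hgeom φ, ← hψ', ← hgeom ψ]
  have h1 := norm_sub_le ((T ^ n) ψ) ψ
  have h2 := norm_pow_apply_le T hT n ψ
  have h3 : C * ‖D.rangeRestrict φ‖ ≤ C * 2 := by gcongr
  linarith

/-- A Koopman operator on a Banach space of functions is not normally solvable if the space
contains, for every `n`, a function of norm at most `1` vanishing on the first `n` points of some
orbit and equal to `1` on the next `n` points. -/
theorem not_normallySolvable_of_forall_exists [CompleteSpace E] {T : E →ₗ[𝕜] E}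
    (hT : ∀ φ, ‖T φ‖ ≤ ‖φ‖) {X : Type*} {F : X → X} (ev : X → E →ₗ[𝕜] 𝕜)
    (hev : ∀ x φ, ‖ev x φ‖ ≤ ‖φ‖) (hevT : ∀ x φ, ev x (T φ) = ev (F x) φ)
    (H : ∀ n : ℕ, ∃ (x : X) (h : E), ‖h‖ ≤ 1 ∧ (∀ j < n, ev (F^[j] x) h = 0) ∧
      ∀ j < n, ev (F^[j + n] x) h = 1) :
    ¬ NormallySolvable T := by
  intro hs
  obtain ⟨C, hC⟩ := hs.exists_bound hT
  obtain ⟨n, hn⟩ := exists_nat_gt C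
  obtain ⟨x, h, hh, h0, h1⟩ := H n
  have hpow : ∀ (j : ℕ) (x : X) (φ : E), ev x ((T ^ j) φ) = ev (F^[j] x) φ := by
    intro j
    induction j with
    | zero => intros; rfl
    | succ j ih =>
      intro x φ
      rw [pow_succ, Module.End.mul_apply, ih, hevT, Function.iterate_succ_apply']
  have hle := (hev x _).trans (hC n h hh)
  rw [map_sub, hpow n, map_sum, map_sum] at hle
  simp only [hpow, ← Function.iterate_add_apply] at hle
  rw [Finset.sum_congr rfl fun j hj => h1 j (Finset.mem_range.1 hj),
    Finset.sum_congr rfl fun j hj => h0 j (Finset.mem_range.1 hj)] at hle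
  simp at hle
  linarith

end Operators

/-! ### Long injective orbit segments and separating functions -/

section Orbits

/-- A mapping all of whose orbits of length `N` have repetitions is preperiodic. -/
theorem exists_injOn_iterate_of_not_isPreperiodic {X : Type*} {F : X → X}
    (hF : ¬ IsPreperiodic F) (N : ℕ) : ∃ x, Set.InjOn (fun j => F^[j] x) (Set.Iio N) := by
  by_contra! hcon
  -- Every orbit becomes periodic before time `N` with a period at most `N`, and `N!` is a common
  -- multiple of these periods.
  refine hF ⟨N, N.factorial, N.factorial_pos, funext fun x => ?_⟩
  obtain ⟨i, j, hij, hjN, hfix⟩ : ∃ i j, i < j ∧ j < N ∧ F^[i] x = F^[j] x := by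
    have hx := hcon x
    simp only [Set.InjOn, Set.mem_Iio, not_forall] at hx
    obtain ⟨i, hi, j, hj, he, hne⟩ := hx
    rcases lt_or_gt_of_ne hne with h | h
    · exact ⟨i, j, h, hj, he⟩
    · exact ⟨j, i, h, hi, he.symm⟩
  have hper : Function.IsPeriodicPt F (j - i) (F^[i] x) := by
    rw [Function.IsPeriodicPt, Function.IsFixedPt, ← Function.iterate_add_apply,
      Nat.sub_add_cancel hij.le, hfix]
  have hper' : Function.IsPeriodicPt F N.factorial (F^[i] x) :=
    hper.trans_dvd (Nat.dvd_factorial (by omega) (by omega))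
  have hN : N = (N - i) + i := by omega
  have := hper'.apply_iterate (N - i)
  rw [← Function.iterate_add_apply, ← hN] at this
  rw [add_comm, Function.iterate_add_apply]
  exact this

/-- Finite sets stay disjoint and closed in the Stone–Čech compactification, which is normal, so
Urysohn's lemma applies there. -/
theorem exists_continuous_zero_one_of_finite {X : Type*} [TopologicalSpace X] [T35Space X]
    {A B : Set X} (hA : A.Finite) (hB : B.Finite) (hAB : Disjoint A B) :
    ∃ f : C(X, ℝ), Set.EqOn f 0 A ∧ Set.EqOn f 1 B ∧ ∀ x, f x ∈ Set.Icc (0 : ℝ) 1 := by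
  obtain ⟨f, h0, h1, hf⟩ := exists_continuous_zero_one_of_isClosed
    (hA.image (stoneCechUnit : X → StoneCech X)).isClosed
    (hB.image (stoneCechUnit : X → StoneCech X)).isClosed
    ((Set.disjoint_image_iff injective_stoneCechUnit_of_t35Space).2 hAB)
  exact ⟨f.comp ⟨stoneCechUnit, continuous_stoneCechUnit⟩, fun x hx => h0 ⟨x, hx, rfl⟩,
    fun x hx => h1 ⟨x, hx, rfl⟩, fun x => hf _⟩

/-- A function of norm at most `1` vanishing on the first `n` points of an injective sequence of
length `2n` and equal to `1` on the others. -/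
theorem exists_continuous_zero_one_of_injOn (𝕜 : Type*) [RCLike 𝕜] {X : Type*}
    [TopologicalSpace X] [T35Space X] {u : ℕ → X} {n : ℕ} (hu : Set.InjOn u (Set.Iio (n + n))) :
    ∃ f : C(X, 𝕜), (∀ x, ‖f x‖ ≤ 1) ∧ (∀ j < n, f (u j) = 0) ∧ ∀ j < n, f (u (j + n)) = 1 := by
  obtain ⟨f, h0, h1, hf⟩ := exists_continuous_zero_one_of_finite
    ((Set.finite_Iio n).image u) ((Set.finite_Iio n).image fun j => u (j + n)) (by
      rw [Set.disjoint_left]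
      rintro _ ⟨i, hi, rfl⟩ ⟨j, hj, he⟩
      simp only [Set.mem_Iio] at hi hj
      have := hu (Set.mem_Iio.2 (by omega)) (Set.mem_Iio.2 (by omega)) he
      omega)
  refine ⟨⟨fun x => (f x : 𝕜), by fun_prop⟩, fun x => ?_, fun j hj => ?_, fun j hj => ?_⟩
  · simpa [abs_of_nonneg (hf x).1] using (hf x).2
  · simpa using h0 ⟨j, hj, rfl⟩
  · simpa using h1 ⟨j, hj, rfl⟩

end Orbits

/-! ### Koopman operators on `CB(X)`, `C(X)` and `B(X)` -/

section Koopman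

variable (𝕜 : Type*) [RCLike 𝕜]

theorem normallySolvable_koopmanCB_iff {X : Type*} [TopologicalSpace X] [T35Space X]
    (F : C(X, X)) : NormallySolvable (koopmanCB 𝕜 F) ↔ IsPreperiodic F := by
  have hT : ∀ φ, ‖koopmanCB 𝕜 F φ‖ ≤ ‖φ‖ := fun φ =>
    (BoundedContinuousFunction.norm_le (norm_nonneg _)).2 fun x => φ.norm_coe_le_norm (F x)
  constructor
  · contrapose
    intro hF
    refine not_normallySolvable_of_forall_exists hT (F := F)
      (fun x => (BoundedContinuousFunction.evalCLM 𝕜 x).toLinearMap)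
      (fun x φ => φ.norm_coe_le_norm x) (fun x φ => rfl) fun n => ?_
    obtain ⟨x, hx⟩ := exists_injOn_iterate_of_not_isPreperiodic hF (n + n)
    obtain ⟨f, hf, h0, h1⟩ := exists_continuous_zero_one_of_injOn 𝕜 hx
    exact ⟨x, BoundedContinuousFunction.ofNormedAddCommGroup f f.continuous 1 hf,
      BoundedContinuousFunction.norm_ofNormedAddCommGroup_le _ zero_le_one hf, h0, h1⟩
  · rintro ⟨l, p, hp, hF⟩
    have hpow : ∀ n φ x, ((koopmanCB 𝕜 F ^ n) φ) x = φ (F^[n] x) := by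
      intro n
      induction n with
      | zero => intros; rfl
      | succ n ih =>
        intro φ x
        rw [pow_succ, Module.End.mul_apply, ih, Function.iterate_succ_apply']
        rfl
    refine normallySolvable_of_pow_add_eq _ hT hp (l := l) ?_
    ext φ x
    rw [hpow, hpow, hF]

theorem normallySolvable_koopmanC_iff {X : Type*} [TopologicalSpace X] [CompactSpace X]
    [T2Space X] (F : C(X, X)) : NormallySolvable (koopmanC 𝕜 F) ↔ IsPreperiodic F := by
  rw [← normallySolvable_koopmanCB_iff 𝕜 F]
  let e := (ContinuousMap.isometryEquivBoundedOfCompact X 𝕜).toHomeomorph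
  rw [NormallySolvable, NormallySolvable, ← e.isClosed_image, ← Set.range_comp,
    ← e.surjective.range_comp]
  rfl

theorem normallySolvable_koopmanB_iff {X : Type*} (F : X → X) :
    NormallySolvable (koopmanB 𝕜 F) ↔ IsPreperiodic F := by
  have hT : ∀ φ, ‖koopmanB 𝕜 F φ‖ ≤ ‖φ‖ := fun φ =>
    lp.norm_le_of_forall_le (norm_nonneg _) fun x =>
      lp.norm_apply_le_norm ENNReal.top_ne_zero φ (F x)
  constructor
  · contrapose
    intro hF
    refine not_normallySolvable_of_forall_exists hT (F := F)
      (fun x => { toFun := fun φ => φ x, map_add' := fun _ _ => rfl, map_smul' := fun _ _ => rfl })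
      (fun x φ => lp.norm_apply_le_norm ENNReal.top_ne_zero φ x) (fun x φ => rfl) fun n => ?_
    obtain ⟨x, hx⟩ := exists_injOn_iterate_of_not_isPreperiodic hF (n + n)
    -- In the discrete topology the separation lemma for continuous functions applies to a bare set.
    let _ : TopologicalSpace X := ⊥
    have : DiscreteTopology X := ⟨rfl⟩
    obtain ⟨f, hf, h0, h1⟩ := exists_continuous_zero_one_of_injOn 𝕜 hx
    refine ⟨x, ⟨fun y => f y, memℓp_infty_iff.2 ⟨1, ?_⟩⟩, ?_, h0, h1⟩
    · rintro _ ⟨y, rfl⟩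
      exact hf y
    · exact lp.norm_le_of_forall_le zero_le_one hf
  · rintro ⟨l, p, hp, hF⟩
    have hpow : ∀ n φ x, ((koopmanB 𝕜 F ^ n) φ) x = φ (F^[n] x) := by
      intro n
      induction n with
      | zero => intros; rfl
      | succ n ih =>
        intro φ x
        rw [pow_succ, Module.End.mul_apply, ih, Function.iterate_succ_apply']
        rfl
    refine normallySolvable_of_pow_add_eq _ hT hp (l := l) ?_
    ext φ x
    rw [hpow, hpow, hF]

end Koopman

/-! ### Shifts on groups -/

section Groups

variable (𝕜 : Type*) [RCLike 𝕜]

theorem isPreperiodic_mul_left_iff {G : Type*} [Group G] (g : G) :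
    IsPreperiodic (g * ·) ↔ IsOfFinOrder g := by
  rw [isOfFinOrder_iff_pow_eq_one]
  constructor
  · rintro ⟨l, p, hp, h⟩
    refine ⟨p, hp, ?_⟩
    rw [mul_left_iterate, mul_left_iterate] at h
    simpa [pow_add] using congrFun h 1
  · rintro ⟨p, hp, h⟩
    refine ⟨0, p, hp, ?_⟩
    rw [zero_add, mul_left_iterate, h]
    ext x
    simp

theorem normallySolvable_shiftCB_iff {G : Type*} [TopologicalSpace G] [Group G]
    [IsTopologicalGroup G] [T2Space G] (g : G) :
    NormallySolvable (shiftCB 𝕜 G g) ↔ IsOfFinOrder g := by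
  have : CompletelyRegularSpace G :=
    let _ := IsTopologicalGroup.rightUniformSpace G
    inferInstance
  have : T35Space G := ⟨⟩
  exact (normallySolvable_koopmanCB_iff 𝕜 (ContinuousMap.mulLeft g)).trans
    (isPreperiodic_mul_left_iff g)

theorem norm_shiftCB_le {G : Type*} [TopologicalSpace G] [Group G] [ContinuousMul G] (g : G)
    (φ : G →ᵇ 𝕜) : ‖shiftCB 𝕜 G g φ‖ ≤ ‖φ‖ :=
  (BoundedContinuousFunction.norm_le (norm_nonneg _)).2 fun x => φ.norm_coe_le_norm (g * x)

/-- Shifts are contractions, so a finite net for the shifts of a nearby function serves for those of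
the limit. Closedness makes `AP` complete, as the open mapping argument requires. -/
theorem isClosed_AP (G : Type*) [TopologicalSpace G] [Group G] [ContinuousMul G] :
    IsClosed (AP 𝕜 G : Set (G →ᵇ 𝕜)) := by
  refine isClosed_of_closure_subset fun ψ hψ => Metric.totallyBounded_iff.2 fun ε hε => ?_
  obtain ⟨φ, hφ, hd⟩ := Metric.mem_closure_iff.1 hψ (ε / 2) (half_pos hε)
  obtain ⟨t, ht, hs⟩ := Metric.totallyBounded_iff.1 hφ (ε / 2) (half_pos hε)
  refine ⟨t, ht, ?_⟩
  rintro _ ⟨g, rfl⟩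
  obtain ⟨u, hu, hdu⟩ := Set.mem_iUnion₂.1 (hs ⟨g, rfl⟩)
  refine Set.mem_iUnion₂.2 ⟨u, hu, ?_⟩
  rw [Metric.mem_ball] at hdu ⊢
  have h1 : dist (shiftCB 𝕜 G g ψ) (shiftCB 𝕜 G g φ) ≤ dist ψ φ := by
    rw [dist_eq_norm, dist_eq_norm, ← map_sub]
    exact norm_shiftCB_le 𝕜 g _
  have h2 := dist_triangle (shiftCB 𝕜 G g ψ) (shiftCB 𝕜 G g φ) u
  simp only at hdu ⊢
  linarith

/-- Continuous functions of a character are almost periodic. -/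
theorem comp_character_mem_AP {G : Type*} [TopologicalSpace G] [Group G] [ContinuousMul G]
    (χ : G →ₜ* Circle) (f : C(Circle, 𝕜)) :
    (BoundedContinuousFunction.mkOfCompact f).compContinuous (χ : C(G, Circle)) ∈ AP 𝕜 G := by
  -- Shifting `f ∘ χ` by `g` rotates `f` by `χ g`, so all shifts lie in the continuous image under
  -- `S` of the compact circle.
  let S : Circle → (G →ᵇ 𝕜) := fun c =>
    (BoundedContinuousFunction.mkOfCompact (f.comp (ContinuousMap.mulLeft c))).compContinuous
      (χ : C(G, Circle))
  have hS : Continuous S := by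
    have h1 : Continuous fun c : Circle => f.comp (ContinuousMap.mulLeft c) :=
      (ContinuousMap.curry (f.comp (⟨fun p : Circle × Circle => p.1 * p.2, by fun_prop⟩ :
        C(Circle × Circle, Circle)))).continuous
    have h2 : Continuous fun c : Circle =>
        BoundedContinuousFunction.mkOfCompact (f.comp (ContinuousMap.mulLeft c)) :=
      (ContinuousMap.isometryEquivBoundedOfCompact Circle 𝕜).continuous.comp h1
    exact (BoundedContinuousFunction.continuous_compContinuous _).comp h2
  refine (isCompact_range hS).totallyBounded.subset ?_
  rintro _ ⟨g, rfl⟩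
  refine ⟨χ g, ?_⟩
  ext x
  exact congrArg f (map_mul χ g x).symm

/-- A character nontrivial on `g^(N!)` suffices: a coincidence among the first `N` powers would give
`χ g` an order dividing `N!`. -/
theorem exists_character_injOn_pow {G : Type*} [TopologicalSpace G] [Group G]
    (hsep : ∀ x y : G, x ≠ y → ∃ χ : G →ₜ* Circle, χ x ≠ χ y) {g : G} (hg : ¬ IsOfFinOrder g)
    (N : ℕ) : ∃ χ : G →ₜ* Circle, Set.InjOn (fun j : ℕ => χ (g ^ j)) (Set.Iio N) := by
  have hne : g ^ N.factorial ≠ 1 := fun h =>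
    hg (isOfFinOrder_iff_pow_eq_one.2 ⟨_, N.factorial_pos, h⟩)
  obtain ⟨χ, hχ⟩ := hsep _ _ hne
  refine ⟨χ, fun i hi j hj hij => ?_⟩
  simp only [map_pow, map_one, Set.mem_Iio] at hχ hi hj hij
  by_contra hne'
  wlog hlt : i < j generalizing i j hi hj
  · exact this j i hj hi hij.symm (Ne.symm hne') (by omega)
  have h1 : χ g ^ (j - i) = 1 := by
    rw [pow_sub _ hlt.le, hij, mul_inv_cancel]
  obtain ⟨k, hk⟩ : j - i ∣ N.factorial := Nat.dvd_factorial (by omega) (by omega)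
  exact hχ (by rw [hk, pow_mul, h1, one_pow])

theorem normallySolvable_shiftAP_iff {G : Type*} [TopologicalSpace G] [Group G]
    [ContinuousMul G] (hsep : ∀ x y : G, x ≠ y → ∃ χ : G →ₜ* Circle, χ x ≠ χ y) (g : G) :
    NormallySolvable (shiftAP 𝕜 G g) ↔ IsOfFinOrder g := by
  have hT : ∀ φ, ‖shiftAP 𝕜 G g φ‖ ≤ ‖φ‖ := fun φ => norm_shiftCB_le 𝕜 g φ
  constructor
  · contrapose
    intro hg
    have : CompleteSpace (AP 𝕜 G) := (isClosed_AP 𝕜 G).completeSpace_coe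
    refine not_normallySolvable_of_forall_exists hT (F := (g * ·))
      (fun x => (BoundedContinuousFunction.evalCLM 𝕜 x).toLinearMap ∘ₗ (AP 𝕜 G).subtype)
      (fun x φ => φ.1.norm_coe_le_norm x) (fun x φ => rfl) fun n => ?_
    obtain ⟨χ, hχ⟩ := exists_character_injOn_pow hsep hg (n + n)
    -- The points are separated on the circle rather than in `G`, so that `f ∘ χ` is almost
    -- periodic.
    obtain ⟨f, hf, h0, h1⟩ := exists_continuous_zero_one_of_injOn 𝕜 hχ
    have horbit : ∀ j : ℕ, (g * ·)^[j] (1 : G) = g ^ j := by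
      intro j
      simp [mul_left_iterate]
    refine ⟨1, ⟨_, comp_character_mem_AP 𝕜 χ f⟩, ?_, fun j hj => ?_, fun j hj => ?_⟩
    · exact (BoundedContinuousFunction.norm_le zero_le_one).2 fun x => hf (χ x)
    · rw [horbit]
      exact h0 j hj
    · rw [horbit]
      exact h1 j hj
  · intro hg
    obtain ⟨p, hp, hgp⟩ := isOfFinOrder_iff_pow_eq_one.1 hg
    have hpow : ∀ (n : ℕ) (φ : AP 𝕜 G) (x : G), ((shiftAP 𝕜 G g ^ n) φ).1 x = φ.1 (g ^ n * x) := by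
      intro n
      induction n with
      | zero => intro φ x; simp
      | succ n ih =>
        intro φ x
        rw [pow_succ, Module.End.mul_apply, ih, pow_succ', mul_assoc]
        rfl
    refine normallySolvable_of_pow_add_eq _ hT hp (l := 0) ?_
    ext φ x
    rw [hpow, hpow, zero_add, hgp, pow_zero]

end Groups

end CohomEq

theorem theorem11p1 (𝕜 : Type*) [RCLike 𝕜] :
    -- compact dynamical systems, in `C(X)`
    (∀ (X : Type*) [TopologicalSpace X] [CompactSpace X] [T2Space X] (F : C(X, X)),
      CohomEq.NormallySolvable (CohomEq.koopmanC 𝕜 F) ↔ CohomEq.IsPreperiodic F) ∧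
    -- completely regular Hausdorff spaces, in `CB(X)`
    (∀ (X : Type*) [TopologicalSpace X] [T35Space X] (F : C(X, X)),
      CohomEq.NormallySolvable (CohomEq.koopmanCB 𝕜 F) ↔ CohomEq.IsPreperiodic F) ∧
    -- arbitrary sets, in `B(X)`
    (∀ (X : Type*) (F : X → X),
      CohomEq.NormallySolvable (CohomEq.koopmanB 𝕜 F) ↔ CohomEq.IsPreperiodic F) ∧
    -- shifts of Hausdorff topological groups, in `CB(G)`
    (∀ (G : Type*) [TopologicalSpace G] [Group G] [IsTopologicalGroup G] [T2Space G] (g : G),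
      CohomEq.NormallySolvable (CohomEq.shiftCB 𝕜 G g) ↔ IsOfFinOrder g) ∧
    -- shifts of commutative groups whose points are separated by characters, in `AP(G)`
    (∀ (G : Type*) [TopologicalSpace G] [CommGroup G] [IsTopologicalGroup G],
      (∀ x y : G, x ≠ y → ∃ χ : G →ₜ* Circle, χ x ≠ χ y) →
      ∀ g : G, CohomEq.NormallySolvable (CohomEq.shiftAP 𝕜 G g) ↔ IsOfFinOrder g) := by
  exact ⟨fun X _ _ _ F => CohomEq.normallySolvable_koopmanC_iff 𝕜 F,
    fun X _ _ F => CohomEq.normallySolvable_koopmanCB_iff 𝕜 F,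
    fun X F => CohomEq.normallySolvable_koopmanB_iff 𝕜 F,
    fun G _ _ _ _ g => CohomEq.normallySolvable_shiftCB_iff 𝕜 g,
    fun G _ _ _ hsep g => CohomEq.normallySolvable_shiftAP_iff 𝕜 hsep g⟩
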